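/- **Proposition 2 (Competitive limits).** Let $\overline X>0$ and let $P:[0,\infty)\to[0,\infty)$ be an inverse demand function that is smooth and strictly decreasing (possibly non-linear) on $[0,\overline X]$, with $P(X)=0$ if and only if $X\ge\overline X$. Let $c\ge 0$ be a constant marginal cost with $c\le P(0)$, let $\overline X_c=P^{-1}(c)\in[0,\overline X]$ be the competitive quantity, and suppose that $P'(\overline X_c)<0$ (one-sided derivative at an endpoint of $[0,\overline X]$). For a sequence $\boldsymbol n=(n_1,\dots,n_T)$ of nonnegative integers consider the sequential quantity game in which the $n_s$ firms of period $s$ observe the cumulative quantity of all firms of earlier periods and then simultaneously choose quantities $x_i\ge 0$; firm $i$'s profit is $x_i\,(P(X)-c)$, where $X$ is the total quantity of all firms. For a pure-strategy subgame-perfect equilibrium let $X^*(\boldsymbol n)$ be the total quantity and $x_i^*(\boldsymbol n)$ the quantity of firm $i$ on the path of play. If $c=0$, only equilibria are considered in which, in every subgame that starts with cumulative quantity below $\overline X$, the total quantity remains below $\overline X$ (for $c>0$ every equilibrium has this property). Fix a period $t$ and the numbers $n_k$, $k\ne t$, and let $n_t\to\infty$, where for each sufficiently large $n_t$ an equilibrium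 of the game $\boldsymbol n$ is given. Then $$\lim_{n_t\to\infty}X^*(\boldsymbol n)=\overline X_c ,$$ and for every period $s$ and every firm $i$ of period $s$ (also if the firm $i$ is chosen depending on $n_t$) $$\lim_{n_t\to\infty}x_i^*(\boldsymbol n)=\begin{cases}0 & \text{if } s\ge t,\\[2pt] \dfrac{\overline X_c}{\prod_{k=1}^{s}(1+n_k)} & \text{if } s<t.\end{cases}$$ -/

import Mathlib

open Filter Topology Set
open scoped ContDiff

namespace SequentialOligopoly

/-- A strategy profile. Periods are numbered `0, 1, …` and the firms of period `s` are numbered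
`0, …, n s - 1`; `σ s i Y` is the quantity that firm `i` of period `s` chooses after observing the
cumulative quantity `Y` of all firms that arrived before period `s`. Values at indices `i ≥ n s`
play no role. -/
abbrev Profile := ℕ → ℕ → ℝ → ℝ

/-- `cumulative n σ m s Y` is the cumulative quantity after the `m` periods `s, …, s + m - 1`
when it is `Y` at the beginning of period `s` and the firms of these periods follow `σ`. -/
def cumulative (n : ℕ → ℕ) (σ : Profile) : ℕ → ℕ → ℝ → ℝ
  | 0, _, Y => Y
  | m + 1, s, Y => cumulative n σ m (s + 1) (Y + ∑ i ∈ Finset.range (n s), σ s i Y)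

/-- The cumulative quantities that can be observed at the beginning of period `s` after arbitrary
(nonnegative) choices of the earlier firms: any `Y ≥ 0`, but only `Y = 0` if nobody arrived
before. -/
def Reachable (n : ℕ → ℕ) (s : ℕ) (Y : ℝ) : Prop :=
  0 ≤ Y ∧ ((∀ k < s, n k = 0) → Y = 0)

/-- The profit of firm `i` of period `s` in the game with periods `0, …, T - 1`, inverse demand `P`
and marginal cost `c`, when the firm observes `Y` and produces `x`, the other firms of period `s`
and all firms of the later periods follow `σ`. -/
noncomputable def profit (P : ℝ → ℝ) (c : ℝ) (T : ℕ) (n : ℕ → ℕ) (σ : Profile)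
    (s i : ℕ) (Y x : ℝ) : ℝ :=
  x * (P (cumulative n σ (T - (s + 1)) (s + 1)
    (Y + ∑ j ∈ (Finset.range (n s)).erase i, σ s j Y + x)) - c)

/-- Subgame-perfect equilibrium (in pure strategies): quantities are nonnegative, and after every
reachable observation each firm's quantity maximizes its profit over all nonnegative quantities,
given the simultaneous choices of its own period and the strategies of its followers. -/
structure IsEquilibrium (P : ℝ → ℝ) (c : ℝ) (T : ℕ) (n : ℕ → ℕ) (σ : Profile) : Prop where
  nonneg : ∀ s < T, ∀ i < n s, ∀ Y, Reachable n s Y → 0 ≤ σ s i Y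
  optimal : ∀ s < T, ∀ i < n s, ∀ Y, Reachable n s Y → ∀ x, 0 ≤ x →
    profit P c T n σ s i Y x ≤ profit P c T n σ s i Y (σ s i Y)

/-- In every subgame that starts with a cumulative quantity below the saturation point, the total
quantity stays below the saturation point. For positive marginal cost every equilibrium has this
property; for zero marginal cost it excludes the degenerate equilibria in which several firms
flood the market and all earn zero whatever they do. -/
def StaysUnsaturated (Xbar : ℝ) (T : ℕ) (n : ℕ → ℕ) (σ : Profile) : Prop :=
  ∀ s < T, ∀ Y, Reachable n s Y → Y < Xbar → cumulative n σ (T - s) s Y < Xbar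

/-- The total quantity on the path of play. -/
def totalQuantity (T : ℕ) (n : ℕ → ℕ) (σ : Profile) : ℝ := cumulative n σ T 0 0

/-- The quantity of firm `i` of period `s` on the path of play. -/
def firmQuantity (n : ℕ → ℕ) (σ : Profile) (s i : ℕ) : ℝ := σ s i (cumulative n σ s 0 0)

end SequentialOligopoly

open SequentialOligopoly

namespace SequentialOligopoly

/-! Continuations are best indexed by the total quantity `X` to which they lead. Suppose `F`
recovers from `X` the cumulative quantity after period `s`. A firm of that period then chooses `X`
to maximize `(F X - R) * (P X - c)`, where `R` is the output of everyone else up to and including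
the period, and its first-order condition says that it produces `φ X * F' X` with `φ = (c - P) /
P'`. Subtracting this once for each firm gives the inverse function one period earlier, `F - n s * φ
* F'`; this is the recursion `inverseTotal`. Since `φ` vanishes at `Xc` with slope `-1`, every
inverse function fixes `Xc` and has there the slope `∏ (1 + n k)`
(`derivWithin_inverseTotal_fixed`).

Monotonicity of the inverse functions is available only near `Xc`, so the path must first be brought
there: `lt_stage_of_many` does this by a deviation of a small firm. Uniformity in the number `N` of
firms of period `t` holds because the inverse functions are affine in `N` (`inverseTotal_update`).

On the path, the inverse function of the whole game vanishes at `X`: `F₀ X + N * (F₁ - F₀) X = 0`,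
where the subscript is the number of firms in period `t`. As `X → Xc`, comparing slopes at `Xc`
forces `N * φ X → Xc / β` with `β` the slope of `F₀`. Inserting this in the first-order condition
yields all the limits (`tendsto_path`). -/

/-- The cumulative quantity after period `s` when it is `Y` before. -/
def stage (n : ℕ → ℕ) (σ : Profile) (s : ℕ) (Y : ℝ) : ℝ :=
  Y + ∑ i ∈ Finset.range (n s), σ s i Y

/-- The total quantity in the subgame that starts in period `s` at `Y`. -/
def finalQuantity (T : ℕ) (n : ℕ → ℕ) (σ : Profile) (s : ℕ) (Y : ℝ) : ℝ :=
  cumulative n σ (T - s) s Y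

theorem finalQuantity_end (T : ℕ) (n : ℕ → ℕ) (σ : Profile) (Y : ℝ) :
    finalQuantity T n σ T Y = Y := by
  simp [finalQuantity, cumulative]

theorem finalQuantity_stage {T s : ℕ} (hs : s < T) (n : ℕ → ℕ) (σ : Profile) (Y : ℝ) :
    finalQuantity T n σ s Y = finalQuantity T n σ (s + 1) (stage n σ s Y) := by
  obtain ⟨m, rfl⟩ : ∃ m, T = s + 1 + m := ⟨T - (s + 1), by omega⟩
  rw [finalQuantity, finalQuantity, show s + 1 + m - s = m + 1 by omega,
    show s + 1 + m - (s + 1) = m by omega]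
  rfl

theorem cumulative_succ_last (n : ℕ → ℕ) (σ : Profile) (m s : ℕ) (Y : ℝ) :
    cumulative n σ (m + 1) s Y = stage n σ (s + m) (cumulative n σ m s Y) := by
  induction m generalizing s Y with
  | zero => rfl
  | succ m ih =>
    rw [cumulative, ih, show s + 1 + m = s + (m + 1) by omega]
    rfl

theorem Reachable.succ_of_pos {n : ℕ → ℕ} {s : ℕ} {Y : ℝ} (hn : 0 < n s) (hY : 0 ≤ Y) :
    Reachable n (s + 1) Y :=
  ⟨hY, fun h => absurd (h s (Nat.lt_succ_self s)) hn.ne'⟩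

/-! ### Consequences of single deviations -/

namespace IsEquilibrium

variable {P : ℝ → ℝ} {c : ℝ} {T : ℕ} {n : ℕ → ℕ} {σ : Profile} {s i : ℕ} {Y : ℝ}

theorem le_stage (h : IsEquilibrium P c T n σ) (hs : s < T) (hY : Reachable n s Y) :
    Y ≤ stage n σ s Y :=
  le_add_of_nonneg_right <| Finset.sum_nonneg fun i hi =>
    h.nonneg s hs i (Finset.mem_range.1 hi) Y hY

theorem reachable_stage (h : IsEquilibrium P c T n σ) (hs : s < T) (hY : Reachable n s Y) :
    Reachable n (s + 1) (stage n σ s Y) := by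
  refine ⟨hY.1.trans (h.le_stage hs hY), fun hn => ?_⟩
  have h0 : Y = 0 := hY.2 fun k hk => hn k (by omega)
  simp [stage, hn s (Nat.lt_succ_self s), h0]

theorem quantity_le (h : IsEquilibrium P c T n σ) (hs : s < T) (hi : i < n s)
    (hY : Reachable n s Y) : Y + σ s i Y ≤ stage n σ s Y := by
  refine add_le_add_right (Finset.single_le_sum (f := fun j => σ s j Y) (fun j hj => ?_)
    (Finset.mem_range.2 hi)) Y
  exact h.nonneg s hs j (Finset.mem_range.1 hj) Y hY

theorem le_finalQuantity (h : IsEquilibrium P c T n σ) (hs : s ≤ T) (hY : Reachable n s Y) :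
    Y ≤ finalQuantity T n σ s Y := by
  induction hs using Nat.decreasingInduction generalizing Y with
  | self => rw [finalQuantity_end]
  | of_succ k hk ih =>
    rw [finalQuantity_stage hk]
    exact (h.le_stage hk hY).trans (ih (h.reachable_stage hk hY))

theorem reachable_path (h : IsEquilibrium P c T n σ) (hs : s ≤ T) :
    Reachable n s (cumulative n σ s 0 0) := by
  induction s with
  | zero => exact ⟨le_rfl, fun _ => rfl⟩
  | succ s ih =>
    rw [cumulative_succ_last, zero_add]
    exact h.reachable_stage hs (ih (by omega))

/-- The deviation is named by the cumulative quantity `W` that it induces after the period; `hW`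
says that the deviating quantity is nonnegative. -/
theorem deviation (h : IsEquilibrium P c T n σ) (hs : s < T) (hi : i < n s)
    (hY : Reachable n s Y) {W : ℝ} (hW : stage n σ s Y - σ s i Y ≤ W) :
    (W - (stage n σ s Y - σ s i Y)) * (P (finalQuantity T n σ (s + 1) W) - c) ≤
      σ s i Y * (P (finalQuantity T n σ (s + 1) (stage n σ s Y)) - c) := by
  have key := h.optimal s hs i hi Y hY (W - (stage n σ s Y - σ s i Y)) (by linarith)
  have e : Y + ∑ j ∈ (Finset.range (n s)).erase i, σ s j Y = stage n σ s Y - σ s i Y := by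
    rw [stage, ← Finset.sum_erase_add _ _ (Finset.mem_range.2 hi)]
    ring
  simpa [profit, e, finalQuantity] using key

theorem profit_nonneg (h : IsEquilibrium P c T n σ) (hs : s < T) (hi : i < n s)
    (hY : Reachable n s Y) :
    0 ≤ σ s i Y * (P (finalQuantity T n σ (s + 1) (stage n σ s Y)) - c) := by
  simpa using h.deviation hs hi hY le_rfl

theorem exists_pos_of_lt_stage (hlt : Y < stage n σ s Y) : ∃ i < n s, 0 < σ s i Y := by
  by_contra! hcon
  have : ∑ i ∈ Finset.range (n s), σ s i Y ≤ 0 :=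
    Finset.sum_nonpos fun i hi => hcon i (Finset.mem_range.1 hi)
  simp only [stage] at hlt
  linarith

/-- Followers only add output, so beyond `Xc` a firm with positive output would make a loss, and
producing nothing is better. -/
theorem stage_le_competitive (h : IsEquilibrium P c T n σ) {Xc : ℝ}
    (hP : ∀ X, Xc < X → P X < c) (hs : s < T) (hY : Reachable n s Y) (hYc : Y ≤ Xc) :
    stage n σ s Y ≤ Xc := by
  by_contra! hcon
  obtain ⟨i, hi, hpos⟩ := exists_pos_of_lt_stage (hYc.trans_lt hcon)
  have h1 := h.profit_nonneg hs hi hY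
  have h2 := h.le_finalQuantity hs (h.reachable_stage hs hY)
  nlinarith [hP _ (hcon.trans_le h2)]

theorem finalQuantity_le_competitive (h : IsEquilibrium P c T n σ) {Xc : ℝ}
    (hP : ∀ X, Xc < X → P X < c) (hs : s ≤ T) (hY : Reachable n s Y) (hYc : Y ≤ Xc) :
    finalQuantity T n σ s Y ≤ Xc := by
  induction hs using Nat.decreasingInduction generalizing Y with
  | self => rwa [finalQuantity_end]
  | of_succ k hk ih =>
    rw [finalQuantity_stage hk]
    exact ih (h.reachable_stage hk hY) (h.stage_le_competitive hP hk hY hYc)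

/-- If a period filled the market exactly to `Xc`, its active firms would earn zero. One of them
could halve its output; by induction the followers would leave the total below `Xc`, so it would
earn a positive profit. -/
theorem finalQuantity_lt_competitive (h : IsEquilibrium P c T n σ) {Xc : ℝ}
    (hP : ∀ X, Xc < X → P X < c) (hPXc : P Xc = c) (hP' : ∀ X, 0 ≤ X → X < Xc → c < P X)
    (hs : s ≤ T) (hY : Reachable n s Y) (hYc : Y < Xc) :
    finalQuantity T n σ s Y < Xc := by
  induction hs using Nat.decreasingInduction generalizing Y with
  | self => rwa [finalQuantity_end]
  | of_succ k hk ih =>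
    rw [finalQuantity_stage hk]
    have hZ := h.reachable_stage hk hY
    refine ih hZ ((h.stage_le_competitive hP hk hY hYc.le).lt_of_ne fun heq => ?_)
    obtain ⟨i, hi, hpos⟩ := exists_pos_of_lt_stage (hYc.trans_eq heq.symm)
    have hle := h.finalQuantity_le_competitive hP hk hZ heq.le
    have hge := h.le_finalQuantity hk hZ
    have hX : finalQuantity T n σ (k + 1) (stage n σ k Y) = Xc :=
      le_antisymm hle (heq ▸ hge)
    have hYle := h.quantity_le hk hi hY
    have hW : Reachable n (k + 1) (stage n σ k Y - σ k i Y / 2) :=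
      .succ_of_pos (by omega) (by linarith [hY.1])
    have hdev := h.deviation hk hi hY (W := stage n σ k Y - σ k i Y / 2) (by linarith)
    have hpr := hP' _ (hW.1.trans (h.le_finalQuantity hk hW)) (ih hW (by linarith))
    rw [hX, hPXc] at hdev
    nlinarith

end IsEquilibrium

/-! ### First-order conditions and backward inversion -/

/-- `F` recovers the cumulative quantity `Y` at the beginning of period `s` from the total quantity
to which it leads, for all observations `Y` between `K` and `Xc`; the total quantities are
between `a` and `Xc`. -/
def InvertedAbove (T : ℕ) (n : ℕ → ℕ) (σ : Profile) (a Xc K : ℝ) (s : ℕ) (F : ℝ → ℝ) : Prop :=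
  ∀ Y, Reachable n s Y → K < Y → Y < Xc →
    finalQuantity T n σ s Y ∈ Ioo a Xc ∧ F (finalQuantity T n σ s Y) = Y

namespace IsEquilibrium

variable {P : ℝ → ℝ} {c : ℝ} {T : ℕ} {n : ℕ → ℕ} {σ : Profile} {s i : ℕ} {Y a Xc K : ℝ}
  {F F' φ : ℝ → ℝ}

/-- An idle firm could add a little output, keep the total below `Xc` and earn a positive profit.
Positivity makes the optimum interior, as the first-order condition requires. -/
theorem quantity_pos (h : IsEquilibrium P c T n σ) (hP : ∀ X, 0 ≤ X → X < Xc → c < P X)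
    (hs : s < T) (hlt : ∀ Y, Reachable n (s + 1) Y → Y < Xc → finalQuantity T n σ (s + 1) Y < Xc)
    (hY : Reachable n s Y) (hZ : stage n σ s Y < Xc) (hi : i < n s) : 0 < σ s i Y := by
  refine (h.nonneg s hs i hi Y hY).lt_of_ne fun h0 => ?_
  obtain ⟨W, hZW, hWc⟩ := exists_between hZ
  have hW : Reachable n (s + 1) W :=
    .succ_of_pos (by omega) ((hY.1.trans (h.le_stage hs hY)).trans hZW.le)
  have hdev := h.deviation hs hi hY (W := W) (by linarith)
  have := hP _ (hW.1.trans (h.le_finalQuantity hs hW)) (hlt W hW hWc)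
  rw [← h0] at hdev
  nlinarith

/-- The first-order condition, with the deviations parametrized by the total quantity to which
they lead. -/
theorem quantity_eq (h : IsEquilibrium P c T n σ) (hP : ∀ X, 0 ≤ X → X < Xc → c < P X)
    (hs : s < T) (hlt : ∀ Y, Reachable n (s + 1) Y → Y < Xc → finalQuantity T n σ (s + 1) Y < Xc)
    (hF : StrictMonoOn F (Ioo a Xc)) (hF' : ∀ X ∈ Ioo a Xc, HasDerivAt F (F' X) X)
    (hφ : ∀ X ∈ Ioo a Xc, ∃ p < 0, HasDerivAt P p X ∧ φ X * p = c - P X)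
    (hinv : InvertedAbove T n σ a Xc K (s + 1) F)
    (hY : Reachable n s Y) (hK : K < stage n σ s Y) (hZ : stage n σ s Y < Xc) (hi : i < n s) :
    σ s i Y = φ (finalQuantity T n σ s Y) * F' (finalQuantity T n σ s Y) := by
  have hpos := h.quantity_pos hP hs hlt hY hZ hi
  have hZr := h.reachable_stage hs hY
  have hle := h.quantity_le hs hi hY
  obtain ⟨hX, hFX⟩ := hinv _ hZr hK hZ
  rw [finalQuantity_stage hs]
  set Z := stage n σ s Y with hZdef
  set X := finalQuantity T n σ (s + 1) Z with hXdef
  obtain ⟨p, hp, hPp, hφp⟩ := hφ X hX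
  -- Every `V` near `X` is the total after a feasible deviation, namely the one that moves the
  -- cumulative quantity to `F V`.
  have hmax : IsLocalMax (fun V => (F V - (Z - σ s i Y)) * (P V - c)) X := by
    have hcont : Tendsto F (𝓝 X) (𝓝 Z) := hFX ▸ (hF' X hX).continuousAt.tendsto
    filter_upwards [Ioo_mem_nhds hX.1 hX.2, hcont.eventually (lt_mem_nhds hK),
      hcont.eventually (lt_mem_nhds (sub_lt_self Z hpos)), hcont.eventually (gt_mem_nhds hZ)]
      with V hV hKV hZV hVc
    have hW : Reachable n (s + 1) (F V) := .succ_of_pos (by omega) (by linarith [hY.1, hZV.le])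
    obtain ⟨h1, h2⟩ := hinv _ hW hKV hVc
    have hdev := h.deviation hs hi hY hZV.le
    -- The total reached from `F V` has the same image under `F` as `V`, hence equals `V`.
    rw [hF.injOn h1 hV h2] at hdev
    simpa [hFX] using hdev
  have hzero := hmax.hasDerivAt_eq_zero (((hF' X hX).sub_const _).mul (hPp.sub_const c))
  rw [hFX] at hzero
  refine mul_right_cancel₀ hp.ne ?_
  linear_combination hzero - F' X * hφp

theorem inverse_stage (h : IsEquilibrium P c T n σ) (hP : ∀ X, 0 ≤ X → X < Xc → c < P X)
    (hs : s < T) (hlt : ∀ Y, Reachable n (s + 1) Y → Y < Xc → finalQuantity T n σ (s + 1) Y < Xc)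
    (hF : StrictMonoOn F (Ioo a Xc)) (hF' : ∀ X ∈ Ioo a Xc, HasDerivAt F (F' X) X)
    (hφ : ∀ X ∈ Ioo a Xc, ∃ p < 0, HasDerivAt P p X ∧ φ X * p = c - P X)
    (hinv : InvertedAbove T n σ a Xc K (s + 1) F)
    (hY : Reachable n s Y) (hK : K < stage n σ s Y) (hZ : stage n σ s Y < Xc) :
    finalQuantity T n σ s Y ∈ Ioo a Xc ∧
      F (finalQuantity T n σ s Y) -
        n s * (φ (finalQuantity T n σ s Y) * F' (finalQuantity T n σ s Y)) = Y := by
  have hsum : ∑ i ∈ Finset.range (n s), σ s i Y =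
      n s * (φ (finalQuantity T n σ s Y) * F' (finalQuantity T n σ s Y)) := by
    rw [Finset.sum_congr rfl fun i hi => h.quantity_eq hP hs hlt hF hF' hφ hinv hY hK hZ
      (Finset.mem_range.1 hi)]
    simp
  obtain ⟨hX, hFX⟩ := hinv _ (h.reachable_stage hs hY) hK hZ
  rw [← finalQuantity_stage hs] at hX hFX
  refine ⟨hX, ?_⟩
  rw [← hsum, hFX, stage]
  ring

/-- With many firms in a period, the cumulative quantity after the period is close to the
competitive quantity: otherwise a small firm gains by expanding. -/
theorem lt_stage_of_many (h : IsEquilibrium P c T n σ) (hc : 0 ≤ c) (ha : 0 ≤ a) (haXc : a < Xc)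
    (hP : ∀ X, 0 ≤ X → X < Xc → c < P X) (hanti : AntitoneOn P (Ici 0))
    (hs : s < T) (hF : StrictMonoOn F (Icc a Xc))
    (hinv : InvertedAbove T n σ a Xc a (s + 1) F)
    {m q : ℝ} (hm : m ∈ Ioo a Xc) (hq : q ∈ Ioo a Xc) (hmq : m ≤ F q)
    (hmany : Xc * P 0 < n s * ((m - a) * (P q - c)))
    (hY : Reachable n s Y) : a < stage n σ s Y := by
  by_contra! hcon
  have hP0 : 0 < P 0 := hc.trans_lt (hP 0 le_rfl (ha.trans_lt haXc))
  have hXc : 0 < Xc := ha.trans_lt haXc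
  have hn : 0 < n s := by
    rcases Nat.eq_zero_or_pos (n s) with h0 | h0
    · rw [h0] at hmany
      have := mul_pos hXc hP0
      norm_num at hmany
      linarith
    · exact h0
  have hn' : (0 : ℝ) < n s := by exact_mod_cast hn
  -- Pigeonhole: the outputs of the period sum to at most `a < Xc`.
  obtain ⟨i, hi, hsmall⟩ : ∃ i < n s, n s * σ s i Y ≤ Xc := by
    by_contra! hbig
    have : ∑ i ∈ Finset.range (n s), Xc / n s ≤ ∑ i ∈ Finset.range (n s), σ s i Y :=
      Finset.sum_le_sum fun i hi => by
        rw [div_le_iff₀' hn']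
        exact (hbig i (Finset.mem_range.1 hi)).le
    rw [Finset.sum_const, Finset.card_range, nsmul_eq_mul, mul_div_cancel₀ _ hn'.ne'] at this
    have := hY.1
    simp only [stage] at hcon
    linarith
  have hx := h.nonneg s hs i hi Y hY
  have hm0 : Reachable n (s + 1) m := .succ_of_pos hn (ha.trans hm.1.le)
  obtain ⟨hXm, hFm⟩ := hinv m hm0 hm.1 hm.2
  -- After a deviation to `m`, the followers stop at a total of at most `q`, so the margin is at
  -- least `P q - c`. This bound does not depend on the size of the period.
  have hXq : finalQuantity T n σ (s + 1) m ≤ q :=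
    (hF.le_iff_le (Ioo_subset_Icc_self hXm) (Ioo_subset_Icc_self hq)).1 (hFm.trans_le hmq)
  have hPq : P q ≤ P (finalQuantity T n σ (s + 1) m) :=
    hanti (ha.trans hXm.1.le) (ha.trans hq.1.le) hXq
  have hcq := hP q (ha.trans hq.1.le) hq.2
  have hZr := h.reachable_stage hs hY
  have hPX : P (finalQuantity T n σ (s + 1) (stage n σ s Y)) ≤ P 0 :=
    hanti self_mem_Ici (hZr.1.trans (h.le_finalQuantity hs hZr))
      (hZr.1.trans (h.le_finalQuantity hs hZr))
  have hdev := h.deviation hs hi hY (W := m) (by linarith [hm.1])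
  have h1 : (m - a) * (P q - c) ≤ σ s i Y * P 0 :=
    calc (m - a) * (P q - c)
        ≤ (m - (stage n σ s Y - σ s i Y)) * (P (finalQuantity T n σ (s + 1) m) - c) :=
          mul_le_mul (by linarith) (by linarith) (by linarith) (by linarith [hm.1])
      _ ≤ σ s i Y * P 0 := hdev.trans (mul_le_mul_of_nonneg_left (by linarith) hx)
  have h2 := mul_le_mul_of_nonneg_left h1 hn'.le
  have h3 := mul_le_mul_of_nonneg_right hsmall hP0.le
  linarith

end IsEquilibrium

/-! ### The inverse functions near the competitive quantity -/

section InverseTotal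

/-- The cumulative quantity at the beginning of period `s`, as a function of the total quantity
after the `m` periods `s, …, s + m - 1` to which it leads; `φ = (c - P) / P'`. -/
noncomputable def inverseTotal (φ : ℝ → ℝ) (I : Set ℝ) (n : ℕ → ℕ) : ℕ → ℕ → ℝ → ℝ
  | 0, _, X => X
  | m + 1, s, X => inverseTotal φ I n m (s + 1) X -
      n s * (φ X * derivWithin (inverseTotal φ I n m (s + 1)) I X)

variable {φ : ℝ → ℝ} {I : Set ℝ}

theorem contDiffOn_inverseTotal (hI : UniqueDiffOn ℝ I) (hφ : ContDiffOn ℝ ∞ φ I) (n : ℕ → ℕ)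
    (m s : ℕ) : ContDiffOn ℝ ∞ (inverseTotal φ I n m s) I := by
  induction m generalizing s with
  | zero => exact contDiffOn_id
  | succ m ih =>
    exact (ih (s + 1)).sub (contDiffOn_const.mul (hφ.mul ((ih (s + 1)).derivWithin hI le_rfl)))

theorem inverseTotal_fixed {b : ℝ} (hb : φ b = 0) (n : ℕ → ℕ) (m s : ℕ) :
    inverseTotal φ I n m s b = b := by
  induction m generalizing s with
  | zero => rfl
  | succ m ih => simp [inverseTotal, ih, hb]

theorem hasDerivWithinAt_inverseTotal (hI : UniqueDiffOn ℝ I) (hφ : ContDiffOn ℝ ∞ φ I)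
    (n : ℕ → ℕ) (m s : ℕ) {X : ℝ} (hX : X ∈ I) :
    HasDerivWithinAt (inverseTotal φ I n m s) (derivWithin (inverseTotal φ I n m s) I X) I X :=
  (((contDiffOn_inverseTotal hI hφ n m s).differentiableOn (by simp)) X hX).hasDerivWithinAt

/-- Differentiating `G - n s * φ * G'` at `b`, the term with `G''` drops out because `φ b = 0`, and
`φ' = -1` leaves `(1 + n s) * G'`. -/
theorem derivWithin_inverseTotal_fixed (hI : UniqueDiffOn ℝ I) (hφ : ContDiffOn ℝ ∞ φ I)
    {b : ℝ} (hbI : b ∈ I) (hb : φ b = 0) (hb' : HasDerivWithinAt φ (-1) I b)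
    (n : ℕ → ℕ) (m s : ℕ) :
    derivWithin (inverseTotal φ I n m s) I b = ∏ j ∈ Finset.range m, (1 + (n (s + j) : ℝ)) := by
  induction m generalizing s with
  | zero => exact (hasDerivWithinAt_id b I).derivWithin (hI b hbI)
  | succ m ih =>
    have hG := hasDerivWithinAt_inverseTotal hI hφ n m (s + 1) hbI
    have hG' := ((((contDiffOn_inverseTotal hI hφ n m (s + 1)).derivWithin hI
      (m := ∞) le_rfl).differentiableOn (by simp)) b hbI).hasDerivWithinAt
    have key := (hG.sub ((hb'.mul hG').const_mul (n s : ℝ))).derivWithin (hI b hbI)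
    refine key.trans ?_
    rw [Finset.prod_range_succ', ih, hb]
    simp only [add_zero, show ∀ k, s + 1 + k = s + (k + 1) by intro k; omega]
    ring

theorem inverseTotal_congr {n n' : ℕ → ℕ} {m s : ℕ} (h : ∀ k, s ≤ k → k < s + m → n k = n' k) :
    inverseTotal φ I n m s = inverseTotal φ I n' m s := by
  induction m generalizing s with
  | zero => rfl
  | succ m ih =>
    funext X
    rw [inverseTotal, inverseTotal, ih fun k h1 h2 => h k (by omega) (by omega),
      h s le_rfl (by omega)]

/-- The number of firms in a single period enters affinely. -/
theorem inverseTotal_update (hI : UniqueDiffOn ℝ I) (hφ : ContDiffOn ℝ ∞ φ I)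
    (n : ℕ → ℕ) (t N m s : ℕ) {X : ℝ} (hX : X ∈ I) :
    inverseTotal φ I (Function.update n t N) m s X =
      inverseTotal φ I (Function.update n t 0) m s X +
        N * (inverseTotal φ I (Function.update n t 1) m s X -
          inverseTotal φ I (Function.update n t 0) m s X) := by
  induction m generalizing s X with
  | zero => simp [inverseTotal]
  | succ m ih =>
    rcases eq_or_ne s t with rfl | hst
    · have hcongr (M M' : ℕ) : inverseTotal φ I (Function.update n s M) m (s + 1) =
          inverseTotal φ I (Function.update n s M') m (s + 1) :=
        inverseTotal_congr fun k h1 h2 => by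
          rw [Function.update_of_ne (by omega), Function.update_of_ne (by omega)]
      simp only [inverseTotal, hcongr N 0, hcongr 1 0, Function.update_self]
      push_cast
      ring
    · have h0 := hasDerivWithinAt_inverseTotal hI hφ (Function.update n t 0) m (s + 1) hX
      have h1 := hasDerivWithinAt_inverseTotal hI hφ (Function.update n t 1) m (s + 1) hX
      have hD := ((h0.add ((h1.sub h0).const_mul (N : ℝ))).congr
        (fun x hx => ih (s + 1) hx) (ih (s + 1) hX)).derivWithin (hI X hX)
      simp only [inverseTotal, Function.update_of_ne hst, ih (s + 1) hX, hD]
      ring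

theorem derivWithin_inverseTotal_update (hI : UniqueDiffOn ℝ I) (hφ : ContDiffOn ℝ ∞ φ I)
    (n : ℕ → ℕ) (t N m s : ℕ) {X : ℝ} (hX : X ∈ I) :
    derivWithin (inverseTotal φ I (Function.update n t N) m s) I X =
      derivWithin (inverseTotal φ I (Function.update n t 0) m s) I X +
        N * (derivWithin (inverseTotal φ I (Function.update n t 1) m s) I X -
          derivWithin (inverseTotal φ I (Function.update n t 0) m s) I X) := by
  have h0 := hasDerivWithinAt_inverseTotal hI hφ (Function.update n t 0) m s hX
  have h1 := hasDerivWithinAt_inverseTotal hI hφ (Function.update n t 1) m s hX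
  exact ((h0.add ((h1.sub h0).const_mul (N : ℝ))).congr
    (fun x hx => inverseTotal_update hI hφ n t N m s hx)
    (inverseTotal_update hI hφ n t N m s hX)).derivWithin (hI X hX)

theorem eventually_strictMonoOn_Icc {a b : ℝ} (hab : a < b) {G : ℝ → ℝ}
    (hG : ContDiffOn ℝ ∞ G (Icc a b)) (hpos : 0 < derivWithin G (Icc a b) b) :
    ∀ᶠ x in 𝓝[<] b, StrictMonoOn G (Icc x b) := by
  have hcont : ContinuousWithinAt (derivWithin G (Icc a b)) (Icc a b) b :=
    hG.continuousOn_derivWithin (uniqueDiffOn_Icc hab) (by simp) b (right_mem_Icc.2 hab.le)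
  have hev : ∀ᶠ x in 𝓝[<] b, 0 < derivWithin G (Icc a b) x := by
    have h1 : ∀ᶠ x in 𝓝[Icc a b] b, 0 < derivWithin G (Icc a b) x :=
      hcont.eventually (lt_mem_nhds hpos)
    rw [nhdsWithin_Icc_eq_nhdsLE hab] at h1
    exact h1.filter_mono (nhdsWithin_mono _ Iio_subset_Iic_self)
  obtain ⟨l, hl, hlb⟩ := (mem_nhdsLT_iff_exists_Ioo_subset).1 hev
  filter_upwards [Ioo_mem_nhdsLT (max_lt hab hl : max a l < b)] with x hx
  have hxa : a < x := (le_max_left _ _).trans_lt hx.1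
  have hxl : l < x := (le_max_right _ _).trans_lt hx.1
  refine strictMonoOn_of_hasDerivWithinAt_pos (f' := derivWithin G (Icc a b)) (convex_Icc x b)
    (hG.continuousOn.mono (Icc_subset_Icc_left hxa.le)) (fun y hy => ?_) (fun y hy => ?_)
  · rw [interior_Icc] at hy
    have hyI : y ∈ Icc a b := ⟨(hxa.trans hy.1).le, hy.2.le⟩
    refine ((hG.differentiableOn (by simp)) y hyI).hasDerivWithinAt.mono ?_
    exact interior_subset.trans (Icc_subset_Icc_left hxa.le)
  · rw [interior_Icc] at hy
    exact hlb ⟨hxl.trans hy.1, hy.2⟩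

theorem prod_update {n : ℕ → ℕ} {t m s : ℕ} (N : ℕ) (hst : s ≤ t) (htm : t < s + m) :
    ∏ j ∈ Finset.range m, (1 + (Function.update n t N (s + j) : ℝ)) =
      (1 + N) * ∏ j ∈ Finset.range m, (1 + (Function.update n t 0 (s + j) : ℝ)) := by
  have hmem : t - s ∈ Finset.range m := Finset.mem_range.2 (by omega)
  rw [← Finset.mul_prod_erase _ _ hmem, ← Finset.mul_prod_erase _ _ hmem,
    show s + (t - s) = t by omega, Function.update_self, Function.update_self]
  rw [Nat.cast_zero, add_zero, one_mul]
  refine congrArg _ (Finset.prod_congr rfl fun j hj => ?_)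
  have : s + j ≠ t := by have := Finset.ne_of_mem_erase hj; omega
  rw [Function.update_of_ne this, Function.update_of_ne this]

/-- One neighborhood serves all `N`: in the affine form, the constant term has positive slope at
`b`, and the coefficient of `N` either has positive slope there or vanishes identically. -/
theorem eventually_strictMonoOn_inverseTotal {a b : ℝ} (hab : a < b)
    (hφ : ContDiffOn ℝ ∞ φ (Icc a b)) (hb : φ b = 0)
    (hb' : HasDerivWithinAt φ (-1) (Icc a b) b) (n : ℕ → ℕ) (t m s : ℕ) :
    ∀ᶠ x in 𝓝[<] b, ∀ N : ℕ,
      StrictMonoOn (inverseTotal φ (Icc a b) (Function.update n t N) m s) (Icc x b) := by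
  have hI := uniqueDiffOn_Icc hab
  have hbI : b ∈ Icc a b := right_mem_Icc.2 hab.le
  have hsm (N : ℕ) := contDiffOn_inverseTotal hI hφ (Function.update n t N) m s
  have hd (N : ℕ) := derivWithin_inverseTotal_fixed hI hφ hbI hb hb' (Function.update n t N) m s
  have h0 := eventually_strictMonoOn_Icc hab (hsm 0) (by rw [hd]; positivity)
  have h1 : ∀ᶠ x in 𝓝[<] b, MonotoneOn (fun X =>
      inverseTotal φ (Icc a b) (Function.update n t 1) m s X -
        inverseTotal φ (Icc a b) (Function.update n t 0) m s X) (Icc x b) := by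
    by_cases hst : s ≤ t ∧ t < s + m
    · refine (eventually_strictMonoOn_Icc hab ((hsm 1).sub (hsm 0)) ?_).mono
        fun x hx => hx.monotoneOn
      have hsub := ((hasDerivWithinAt_inverseTotal hI hφ (Function.update n t 1) m s hbI).sub
        (hasDerivWithinAt_inverseTotal hI hφ (Function.update n t 0) m s hbI)).derivWithin
        (hI b hbI)
      refine lt_of_lt_of_eq ?_ hsub.symm
      rw [hd, hd, prod_update 1 hst.1 hst.2, ← sub_one_mul]
      norm_num
      positivity
    · have hcongr : inverseTotal φ (Icc a b) (Function.update n t 1) m s =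
          inverseTotal φ (Icc a b) (Function.update n t 0) m s :=
        inverseTotal_congr fun k h1 h2 => by
          rw [Function.update_of_ne (by rintro rfl; exact hst ⟨h1, h2⟩),
            Function.update_of_ne (by rintro rfl; exact hst ⟨h1, h2⟩)]
      refine Eventually.of_forall fun x => ?_
      simpa [hcongr] using monotoneOn_const
  filter_upwards [h0, h1, Ioo_mem_nhdsLT hab] with x hx0 hx1 hxab N
  intro X hX Y hY hXY
  have hX' : X ∈ Icc a b := ⟨hxab.1.le.trans hX.1, hX.2⟩
  have hY' : Y ∈ Icc a b := ⟨hxab.1.le.trans hY.1, hY.2⟩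
  rw [inverseTotal_update hI hφ n t N m s hX', inverseTotal_update hI hφ n t N m s hY']
  exact add_lt_add_of_lt_of_le (hx0 hX hY hXY)
    (mul_le_mul_of_nonneg_left (hx1 hX hY hXY.le) N.cast_nonneg)

end InverseTotal

/-! ### Locating the path of play near the competitive quantity -/

/-- Left of the competitive quantity `Xc`, down to `a`, demand is smooth with negative slope, and
`φ` is the ratio of the margin and the absolute slope. -/
structure CompetitiveRegion (P : ℝ → ℝ) (c Xc a : ℝ) (φ : ℝ → ℝ) : Prop where
  cost_nonneg : 0 ≤ c
  left_nonneg : 0 ≤ a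
  left_lt : a < Xc
  margin_pos : ∀ X, 0 ≤ X → X < Xc → c < P X
  antitone : AntitoneOn P (Ici 0)
  smooth : ContDiffOn ℝ ∞ φ (Icc a Xc)
  fixed : φ Xc = 0
  slope : HasDerivWithinAt φ (-1) (Icc a Xc) Xc
  ratio : ∀ X ∈ Ioo a Xc, ∃ p < 0, HasDerivAt P p X ∧ φ X * p = c - P X

theorem path_stage (n : ℕ → ℕ) (σ : Profile) (s : ℕ) :
    stage n σ s (cumulative n σ s 0 0) = cumulative n σ (s + 1) 0 0 := by
  rw [cumulative_succ_last, zero_add]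

theorem finalQuantity_path {T s : ℕ} (hs : s ≤ T) (n : ℕ → ℕ) (σ : Profile) :
    finalQuantity T n σ s (cumulative n σ s 0 0) = totalQuantity T n σ := by
  induction hs using Nat.decreasingInduction with
  | self => exact finalQuantity_end T n σ _
  | of_succ k hk ih => rw [finalQuantity_stage hk, path_stage, ih]

namespace CompetitiveRegion

variable {P : ℝ → ℝ} {c : ℝ} {T : ℕ} {n : ℕ → ℕ} {σ : Profile} {s r : ℕ} {a₀ a Xc K K' : ℝ}
  {φ : ℝ → ℝ}

theorem hasDerivAt_inverseTotal (hR : CompetitiveRegion P c Xc a₀ φ) (n : ℕ → ℕ) (m s : ℕ) {X : ℝ}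
    (hX : X ∈ Ioo a₀ Xc) :
    HasDerivAt (inverseTotal φ (Icc a₀ Xc) n m s)
      (derivWithin (inverseTotal φ (Icc a₀ Xc) n m s) (Icc a₀ Xc) X) X :=
  (hasDerivWithinAt_inverseTotal (uniqueDiffOn_Icc hR.left_lt) hR.smooth n m s
    (Ioo_subset_Icc_self hX)).hasDerivAt (Icc_mem_nhds hX.1 hX.2)

theorem ratio_of_le (hR : CompetitiveRegion P c Xc a₀ φ) (ha : a₀ ≤ a) :
    ∀ X ∈ Ioo a Xc, ∃ p < 0, HasDerivAt P p X ∧ φ X * p = c - P X :=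
  fun X hX => hR.ratio X ⟨ha.trans_lt hX.1, hX.2⟩

theorem quantity_eq (hR : CompetitiveRegion P c Xc a₀ φ) (ha : a₀ ≤ a)
    (h : IsEquilibrium P c T n σ)
    (hlt : ∀ s ≤ T, ∀ Y, Reachable n s Y → Y < Xc → finalQuantity T n σ s Y < Xc)
    (hs : s < T)
    (hmono : StrictMonoOn (inverseTotal φ (Icc a₀ Xc) n (T - (s + 1)) (s + 1)) (Icc a Xc))
    (hinv : InvertedAbove T n σ a Xc K (s + 1)
      (inverseTotal φ (Icc a₀ Xc) n (T - (s + 1)) (s + 1)))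
    {Y : ℝ} (hY : Reachable n s Y) (hK : K < stage n σ s Y) (hZ : stage n σ s Y < Xc)
    {i : ℕ} (hi : i < n s) :
    σ s i Y = φ (finalQuantity T n σ s Y) *
      derivWithin (inverseTotal φ (Icc a₀ Xc) n (T - (s + 1)) (s + 1)) (Icc a₀ Xc)
        (finalQuantity T n σ s Y) :=
  h.quantity_eq hR.margin_pos hs (hlt (s + 1) hs) (hmono.mono Ioo_subset_Icc_self)
    (F' := derivWithin (inverseTotal φ (Icc a₀ Xc) n (T - (s + 1)) (s + 1)) (Icc a₀ Xc))
    (fun _ hX => hR.hasDerivAt_inverseTotal n _ _ ⟨ha.trans_lt hX.1, hX.2⟩) (hR.ratio_of_le ha)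
    hinv hY hK hZ hi

/-- The threshold may drop from `K'` to `K` when the period itself carries the quantity above `K'`;
at a period with many firms this removes the restriction on the observation. -/
theorem invertedAbove_step (hR : CompetitiveRegion P c Xc a₀ φ) (ha : a₀ ≤ a)
    (h : IsEquilibrium P c T n σ)
    (hlt : ∀ s ≤ T, ∀ Y, Reachable n s Y → Y < Xc → finalQuantity T n σ s Y < Xc)
    (hs : s < T)
    (hmono : StrictMonoOn (inverseTotal φ (Icc a₀ Xc) n (T - (s + 1)) (s + 1)) (Icc a Xc))
    (hK : ∀ Y, Reachable n s Y → K < Y → Y < Xc → K' < stage n σ s Y)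
    (hinv : InvertedAbove T n σ a Xc K' (s + 1)
      (inverseTotal φ (Icc a₀ Xc) n (T - (s + 1)) (s + 1))) :
    InvertedAbove T n σ a Xc K s (inverseTotal φ (Icc a₀ Xc) n (T - s) s) := by
  intro Y hY hKY hYc
  have hZ : stage n σ s Y < Xc := by
    refine (h.le_finalQuantity hs (h.reachable_stage hs hY)).trans_lt ?_
    rw [← finalQuantity_stage hs]
    exact hlt s hs.le Y hY hYc
  have key := h.inverse_stage hR.margin_pos hs (hlt (s + 1) hs) (hmono.mono Ioo_subset_Icc_self)
    (F' := derivWithin (inverseTotal φ (Icc a₀ Xc) n (T - (s + 1)) (s + 1)) (Icc a₀ Xc))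
    (fun X hX => hR.hasDerivAt_inverseTotal n _ _ ⟨ha.trans_lt hX.1, hX.2⟩) (hR.ratio_of_le ha)
    hinv hY (hK Y hY hKY hYc) hZ
  rw [show T - s = T - (s + 1) + 1 by omega]
  exact key

theorem invertedAbove_of_le (hR : CompetitiveRegion P c Xc a₀ φ) (ha : a₀ ≤ a)
    (h : IsEquilibrium P c T n σ)
    (hlt : ∀ s ≤ T, ∀ Y, Reachable n s Y → Y < Xc → finalQuantity T n σ s Y < Xc)
    (hmono : ∀ s ≤ T, StrictMonoOn (inverseTotal φ (Icc a₀ Xc) n (T - s) s) (Icc a Xc))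
    (hr : r ≤ T) (hinv : InvertedAbove T n σ a Xc K r (inverseTotal φ (Icc a₀ Xc) n (T - r) r))
    (hs : s ≤ r) :
    InvertedAbove T n σ a Xc K s (inverseTotal φ (Icc a₀ Xc) n (T - s) s) := by
  induction hs using Nat.decreasingInduction with
  | self => exact hinv
  | of_succ k hk ih =>
    exact hR.invertedAbove_step ha h hlt (by omega) (hmono _ (by omega))
      (fun Y hY hKY _ => hKY.trans_le (h.le_stage (by omega) hY)) ih

theorem invertedAbove_left (hR : CompetitiveRegion P c Xc a₀ φ) (ha : a₀ ≤ a)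
    (h : IsEquilibrium P c T n σ)
    (hlt : ∀ s ≤ T, ∀ Y, Reachable n s Y → Y < Xc → finalQuantity T n σ s Y < Xc)
    (hmono : ∀ s ≤ T, StrictMonoOn (inverseTotal φ (Icc a₀ Xc) n (T - s) s) (Icc a Xc))
    (hs : s ≤ T) :
    InvertedAbove T n σ a Xc a s (inverseTotal φ (Icc a₀ Xc) n (T - s) s) := by
  refine hR.invertedAbove_of_le ha h hlt hmono le_rfl (fun Y _ haY hYc => ?_) hs
  rw [finalQuantity_end, Nat.sub_self]
  exact ⟨⟨haY, hYc⟩, rfl⟩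

/-- The path of play when period `t` has many firms. -/
theorem path_of_many (hR : CompetitiveRegion P c Xc a₀ φ) (ha : a₀ ≤ a) (haXc : a < Xc)
    (h : IsEquilibrium P c T n σ)
    (hlt : ∀ s ≤ T, ∀ Y, Reachable n s Y → Y < Xc → finalQuantity T n σ s Y < Xc)
    (hmono : ∀ s ≤ T, StrictMonoOn (inverseTotal φ (Icc a₀ Xc) n (T - s) s) (Icc a Xc))
    {t : ℕ} (ht : t < T) {m q : ℝ} (hm : m ∈ Ioo a Xc) (hq : q ∈ Ioo a Xc)
    (hmq : m ≤ inverseTotal φ (Icc a₀ Xc) n (T - (t + 1)) (t + 1) q)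
    (hmany : Xc * P 0 < n t * ((m - a) * (P q - c))) :
    totalQuantity T n σ ∈ Ioo a Xc ∧
    inverseTotal φ (Icc a₀ Xc) n T 0 (totalQuantity T n σ) = 0 ∧
    ∀ s < T, ∀ i < n s, firmQuantity n σ s i = φ (totalQuantity T n σ) *
      derivWithin (inverseTotal φ (Icc a₀ Xc) n (T - (s + 1)) (s + 1)) (Icc a₀ Xc)
        (totalQuantity T n σ) := by
  have ha0 : 0 ≤ a := hR.left_nonneg.trans ha
  have hleft (s : ℕ) (hs : s ≤ T) := hR.invertedAbove_left ha h hlt hmono hs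
  have hstage (Y : ℝ) (hY : Reachable n t Y) : a < stage n σ t Y :=
    h.lt_stage_of_many hR.cost_nonneg ha0 haXc hR.margin_pos hR.antitone ht
      (hmono _ ht) (hleft _ ht) hm hq hmq hmany hY
  -- Observations are nonnegative, so the threshold `-1` is no restriction: up to period `t` the
  -- inversion holds even from `0`.
  have hall (s : ℕ) (hs : s ≤ t) := hR.invertedAbove_of_le (K := -1) ha h hlt hmono ht.le
    (hR.invertedAbove_step ha h hlt ht (hmono _ ht) (fun Y hY _ _ => hstage Y hY)
      (hleft _ ht)) hs
  have hzero := hall 0 (Nat.zero_le t) 0 ⟨le_rfl, fun _ => rfl⟩ (by norm_num)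
    (ha0.trans_lt haXc)
  rw [show finalQuantity T n σ 0 0 = totalQuantity T n σ from rfl, Nat.sub_zero] at hzero
  refine ⟨hzero.1, hzero.2, fun s hs i hi => ?_⟩
  have hpath (s : ℕ) (hs : s ≤ T) := h.reachable_path hs
  have hafter (s : ℕ) (hs : t + 1 ≤ s) : s ≤ T → a < cumulative n σ s 0 0 := by
    induction s, hs using Nat.le_induction with
    | base =>
      intro _
      rw [← path_stage]
      exact hstage _ (hpath t ht.le)
    | succ s hs ih =>
      intro hsT
      rw [← path_stage]
      exact (ih (by omega)).trans_le (h.le_stage (by omega) (hpath s (by omega)))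
  have hZ : stage n σ s (cumulative n σ s 0 0) < Xc := by
    rw [path_stage]
    refine (h.le_finalQuantity hs (hpath _ hs)).trans_lt ?_
    rw [finalQuantity_path hs]
    exact hzero.1.2
  have key (K : ℝ) (hK : K < stage n σ s (cumulative n σ s 0 0))
      (hinv : InvertedAbove T n σ a Xc K (s + 1)
        (inverseTotal φ (Icc a₀ Xc) n (T - (s + 1)) (s + 1))) := by
    have := hR.quantity_eq ha h hlt hs (hmono _ hs) hinv (hpath s hs.le) hK hZ hi
    rwa [finalQuantity_path hs.le] at this
  rcases lt_or_ge s t with hst | hst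
  · refine key (-1) ?_ (hall (s + 1) hst)
    rw [path_stage]
    linarith [(hpath (s + 1) hs).1]
  · refine key a ?_ (hleft (s + 1) hs)
    rw [path_stage]
    exact hafter (s + 1) (by omega) hs

theorem eventually_strictMonoOn (hR : CompetitiveRegion P c Xc a₀ φ) (n : ℕ → ℕ) (t T : ℕ) :
    ∀ᶠ a in 𝓝[<] Xc, ∀ N : ℕ, ∀ s ≤ T, StrictMonoOn
      (inverseTotal φ (Icc a₀ Xc) (Function.update n t N) (T - s) s) (Icc a Xc) := by
  have := (eventually_all_finset (Finset.range (T + 1))).2 fun s (_ : s ∈ Finset.range (T + 1)) =>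
    eventually_strictMonoOn_inverseTotal hR.left_lt hR.smooth hR.fixed hR.slope n t (T - s) s
  filter_upwards [this] with a ha N s hs
  exact ha s (Finset.mem_range.2 (by omega)) N

theorem eventually_path (hR : CompetitiveRegion P c Xc a₀ φ) {n : ℕ → ℕ} {t T : ℕ} (ht : t < T)
    {σ : ℕ → Profile}
    (heq : ∀ᶠ N in atTop, IsEquilibrium P c T (Function.update n t N) (σ N))
    (hlt : ∀ᶠ N in atTop, ∀ s ≤ T, ∀ Y, Reachable (Function.update n t N) s Y → Y < Xc →
      finalQuantity T (Function.update n t N) (σ N) s Y < Xc) :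
    ∀ᶠ a in 𝓝[<] Xc, ∀ᶠ N in atTop,
      totalQuantity T (Function.update n t N) (σ N) ∈ Ioo a Xc ∧
      inverseTotal φ (Icc a₀ Xc) (Function.update n t N) T 0
        (totalQuantity T (Function.update n t N) (σ N)) = 0 ∧
      ∀ s < T, ∀ i < Function.update n t N s,
        firmQuantity (Function.update n t N) (σ N) s i =
          φ (totalQuantity T (Function.update n t N) (σ N)) *
            derivWithin (inverseTotal φ (Icc a₀ Xc) (Function.update n t N) (T - (s + 1)) (s + 1))
              (Icc a₀ Xc) (totalQuantity T (Function.update n t N) (σ N)) := by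
  filter_upwards [hR.eventually_strictMonoOn n t T, Ioo_mem_nhdsLT hR.left_lt] with a hmono ha
  have hm : (a + Xc) / 2 ∈ Ioo a Xc := ⟨by linarith [ha.2], by linarith [ha.2]⟩
  have hcont := (contDiffOn_inverseTotal (uniqueDiffOn_Icc hR.left_lt) hR.smooth
    (Function.update n t 0) (T - (t + 1)) (t + 1)).continuousOn Xc (right_mem_Icc.2 hR.left_lt.le)
  rw [ContinuousWithinAt, inverseTotal_fixed hR.fixed, nhdsWithin_Icc_eq_nhdsLE hR.left_lt] at hcont
  -- The inverse function after period `t` does not involve `N`, so `q`, and with it the gain from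
  -- deviating, can be fixed before `N` grows.
  obtain ⟨q, hmq, hq⟩ := (((hcont.mono_left (nhdsWithin_mono _ Iio_subset_Iic_self)).eventually
    (lt_mem_nhds hm.2)).and (Ioo_mem_nhdsLT ha.2)).exists
  have hgain : 0 < ((a + Xc) / 2 - a) * (P q - c) :=
    mul_pos (sub_pos.2 hm.1)
      (sub_pos.2 (hR.margin_pos q (hR.left_nonneg.trans (ha.1.trans hq.1).le) hq.2))
  have hlarge := (tendsto_natCast_atTop_atTop.atTop_mul_const hgain).eventually_gt_atTop (Xc * P 0)
  filter_upwards [heq, hlt, hlarge] with N hN hltN hmany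
  refine hR.path_of_many ha.1.le ha.2 hN hltN (hmono N) ht hm hq ?_ (by simpa using hmany)
  rw [inverseTotal_congr (n' := Function.update n t 0) fun k h1 h2 => by
    rw [Function.update_of_ne (by omega), Function.update_of_ne (by omega)]]
  exact hmq.le

end CompetitiveRegion

/-! ### Passing to the limit -/

theorem tendsto_div_sub_of_hasDerivWithinAt {ι : Type*} {l : Filter ι} {I : Set ℝ} {b f' : ℝ}
    {f : ℝ → ℝ} (hf : HasDerivWithinAt f f' I b) (hb : f b = 0) {X : ι → ℝ}
    (hX : Tendsto X l (𝓝 b)) (hXI : ∀ᶠ N in l, X N ∈ I ∧ X N < b) :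
    Tendsto (fun N => f (X N) / (X N - b)) l (𝓝 f') := by
  have h := (hasDerivWithinAt_iff_tendsto_slope.1 hf).comp
    (tendsto_nhdsWithin_iff.2 ⟨hX, hXI.mono fun N hN => ⟨hN.1, hN.2.ne⟩⟩)
  refine h.congr fun N => ?_
  simp [slope_def_field, hb]

theorem prod_update_split (n : ℕ → ℕ) {s t T : ℕ} (hst : s < t) (ht : t < T) :
    ∏ j ∈ Finset.range T, (1 + (Function.update n t 0 (0 + j) : ℝ)) =
      (∏ k ∈ Finset.range (s + 1), (1 + (n k : ℝ))) *
        ∏ j ∈ Finset.range (T - (s + 1)), (1 + (Function.update n t 0 (s + 1 + j) : ℝ)) := by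
  obtain ⟨m, rfl⟩ : ∃ m, T = s + 1 + m := ⟨T - (s + 1), by omega⟩
  rw [Finset.prod_range_add, Nat.add_sub_cancel_left]
  simp only [zero_add]
  congr 1
  refine Finset.prod_congr rfl fun k hk => ?_
  rw [Function.update_of_ne (by have := Finset.mem_range.1 hk; omega)]

theorem CompetitiveRegion.tendsto_path {P : ℝ → ℝ} {c Xc a : ℝ} {φ : ℝ → ℝ}
    (hR : CompetitiveRegion P c Xc a φ) {n : ℕ → ℕ} {t T : ℕ} (ht : t < T)
    {σ : ℕ → Profile}
    (heq : ∀ᶠ N in atTop, IsEquilibrium P c T (Function.update n t N) (σ N))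
    (hlt : ∀ᶠ N in atTop, ∀ s ≤ T, ∀ Y, Reachable (Function.update n t N) s Y → Y < Xc →
      finalQuantity T (Function.update n t N) (σ N) s Y < Xc) :
    Tendsto (fun N => totalQuantity T (Function.update n t N) (σ N)) atTop (𝓝 Xc) ∧
    ∀ s < T, ∀ i : ℕ → ℕ, (∀ᶠ N in atTop, i N < Function.update n t N s) →
      Tendsto (fun N => firmQuantity (Function.update n t N) (σ N) s (i N)) atTop
        (𝓝 (if t ≤ s then 0 else Xc / ∏ k ∈ Finset.range (s + 1), (1 + (n k : ℝ)))) := by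
  have hpath := hR.eventually_path ht heq hlt
  set X : ℕ → ℝ := fun N => totalQuantity T (Function.update n t N) (σ N) with hXdef
  have hXI : ∀ᶠ N in atTop, X N ∈ Ioo a Xc := by
    obtain ⟨x, hx, hax⟩ := (hpath.and (Ioo_mem_nhdsLT hR.left_lt)).exists
    exact hx.mono fun N hN => ⟨hax.1.trans hN.1.1, hN.1.2⟩
  have hX : Tendsto X atTop (𝓝 Xc) := by
    refine tendsto_order.2 ⟨fun l hl => ?_, fun u hu => hXI.mono fun N hN => hN.2.trans hu⟩
    obtain ⟨x, hx, hlx⟩ := (hpath.and (Ioo_mem_nhdsLT hl)).exists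
    exact hx.mono fun N hN => hlx.1.trans hN.1.1
  refine ⟨hX, fun s hs i hi => ?_⟩
  obtain ⟨x, hx, -⟩ := (hpath.and (Ioo_mem_nhdsLT hR.left_lt)).exists
  have hI := uniqueDiffOn_Icc hR.left_lt
  have hXcI : Xc ∈ Icc a Xc := right_mem_Icc.2 hR.left_lt.le
  have hXIcc : ∀ᶠ N in atTop, X N ∈ Icc a Xc := hXI.mono fun N hN => Ioo_subset_Icc_self hN
  have hXw : Tendsto X atTop (𝓝[Icc a Xc] Xc) := tendsto_nhdsWithin_iff.2 ⟨hX, hXIcc⟩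
  have hXlt : ∀ᶠ N in atTop, X N ∈ Icc a Xc ∧ X N < Xc :=
    hXI.mono fun N hN => ⟨Ioo_subset_Icc_self hN, hN.2⟩
  have hφ0 : Tendsto (fun N => φ (X N)) atTop (𝓝 0) :=
    hR.fixed ▸ (hR.smooth.continuousOn Xc hXcI).tendsto.comp hXw
  have hβ (m s : ℕ) (M : ℕ) := derivWithin_inverseTotal_fixed hI hR.smooth hXcI hR.fixed hR.slope
    (Function.update n t M) m s
  have hF (m s : ℕ) (M : ℕ) := hasDerivWithinAt_inverseTotal hI hR.smooth
    (Function.update n t M) m s hXcI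
  have hφslope := tendsto_div_sub_of_hasDerivWithinAt hR.slope hR.fixed hX hXlt
  set β : ℝ := ∏ j ∈ Finset.range T, (1 + (Function.update n t 0 (0 + j) : ℝ)) with hβdef
  have hβpos : 0 < β := Finset.prod_pos fun j _ => by positivity
  have hCslope := tendsto_div_sub_of_hasDerivWithinAt ((hF T 0 1).sub (hF T 0 0))
    (by simp [inverseTotal_fixed hR.fixed]) hX hXlt
  rw [hβ, hβ, prod_update 1 (Nat.zero_le t) (by omega), ← hβdef,
    show (1 + ((1 : ℕ) : ℝ)) * β - β = β by push_cast; ring] at hCslope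
  have hF0 : Tendsto (fun N => inverseTotal φ (Icc a Xc) (Function.update n t 0) T 0 (X N)) atTop
      (𝓝 Xc) := by
    have := (hF T 0 0).continuousWithinAt.tendsto.comp hXw
    rwa [inverseTotal_fixed hR.fixed] at this
  -- Solving the affine equation for `N` gives `N * φ = -F₀ * φ / (F₁ - F₀)`; after division by `X N
  -- - Xc`, `φ` tends to `-1` and `F₁ - F₀` to `2 * β - β = β`.
  have hNφ : Tendsto (fun N : ℕ => N * φ (X N)) atTop (𝓝 (Xc / β)) := by
    have hlim := (hF0.neg.mul hφslope).div hCslope hβpos.ne'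
    rw [neg_mul_neg, mul_one] at hlim
    refine hlim.congr' ?_
    filter_upwards [hx, hXI, hCslope.eventually_ne hβpos.ne']
      with N hN hNI hne
    have hzero := hN.2.1
    rw [inverseTotal_update hI hR.smooth n t N T 0 (Ioo_subset_Icc_self hNI)] at hzero
    have hu : X N - Xc ≠ 0 := (sub_neg.2 hNI.2).ne
    simp only [Pi.sub_apply, Pi.div_apply] at hne ⊢
    rw [div_eq_iff hne]
    field_simp
    linear_combination (-φ (X N)) * hzero
  have hD (M : ℕ) : Tendsto (fun N => derivWithin
      (inverseTotal φ (Icc a Xc) (Function.update n t M) (T - (s + 1)) (s + 1)) (Icc a Xc) (X N))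
      atTop (𝓝 (∏ j ∈ Finset.range (T - (s + 1)),
        (1 + (Function.update n t M (s + 1 + j) : ℝ)))) := by
    rw [← hβ]
    exact ((contDiffOn_inverseTotal hI hR.smooth _ _ _).continuousOn_derivWithin hI (by simp)
      Xc hXcI).tendsto.comp hXw
  have hlim := (hφ0.mul (hD 0)).add (hNφ.mul ((hD 1).sub (hD 0)))
  have hfirm := hlim.congr'
      (f₂ := fun N => firmQuantity (Function.update n t N) (σ N) s (i N)) <| by
    filter_upwards [hx, hXIcc, hi] with N hN hNI hiN
    rw [hN.2.2 s hs _ hiN, derivWithin_inverseTotal_update hI hR.smooth n t N _ _ hNI]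
    ring
  convert hfirm using 2
  rcases lt_or_ge s t with hst | hst
  -- Before `t`, the coefficient of `N * φ` tends to the part of `β` from periods after `s`, which
  -- cancels. From `t` on, the later inverse functions do not involve `N` and the coefficient tends
  -- to zero.
  · rw [if_neg (by omega), hβdef, prod_update_split n hst ht, prod_update 1 hst (by omega)]
    have h1 : 0 < ∏ k ∈ Finset.range (s + 1), (1 + (n k : ℝ)) :=
      Finset.prod_pos fun j _ => by positivity
    have h2 : 0 < ∏ j ∈ Finset.range (T - (s + 1)),
        (1 + (Function.update n t 0 (s + 1 + j) : ℝ)) := Finset.prod_pos fun j _ => by positivity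
    push_cast
    field_simp
    ring
  · rw [if_pos hst]
    have : ∏ j ∈ Finset.range (T - (s + 1)), (1 + (Function.update n t 1 (s + 1 + j) : ℝ)) =
        ∏ j ∈ Finset.range (T - (s + 1)), (1 + (Function.update n t 0 (s + 1 + j) : ℝ)) :=
      Finset.prod_congr rfl fun j _ => by
        rw [Function.update_of_ne (by omega), Function.update_of_ne (by omega)]
    rw [this]
    ring

/-- By continuity the slope of demand stays negative slightly to the left of `Xc`. Working on that
side only also covers `Xc = Xbar`, where demand may have a kink. -/
theorem exists_competitiveRegion {P : ℝ → ℝ} {Xbar c Xc : ℝ}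
    (hsmooth : ContDiffOn ℝ ∞ P (Icc 0 Xbar)) (hXbar : 0 < Xbar) (hc : 0 ≤ c)
    (hXc : Xc ∈ Icc 0 Xbar) (hpos : 0 < Xc) (hPXc : P Xc = c)
    (hslope : derivWithin P (Icc 0 Xbar) Xc < 0)
    (hmargin : ∀ X, 0 ≤ X → X < Xc → c < P X) (hanti : AntitoneOn P (Ici 0)) :
    ∃ a φ, CompetitiveRegion P c Xc a φ := by
  have hU := uniqueDiffOn_Icc hXbar
  have hdP : ContDiffOn ℝ ∞ (derivWithin P (Icc 0 Xbar)) (Icc 0 Xbar) :=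
    hsmooth.derivWithin hU le_rfl
  have hev : ∀ᶠ x in 𝓝[Icc 0 Xc] Xc, derivWithin P (Icc 0 Xbar) x < 0 :=
    ((hdP.continuousOn Xc hXc).eventually (gt_mem_nhds hslope)).filter_mono
      (nhdsWithin_mono _ (Icc_subset_Icc_right hXc.2))
  rw [nhdsWithin_Icc_eq_nhdsLE hpos] at hev
  obtain ⟨a, ⟨ha0, haXc⟩, ha⟩ := (mem_nhdsLE_iff_exists_mem_Ico_Ioc_subset hpos).1 hev
  obtain ⟨b, hab, hbXc⟩ := exists_between haXc
  have hsub : Icc b Xc ⊆ Icc 0 Xbar := Icc_subset_Icc (ha0.trans hab.le) hXc.2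
  have hneg : ∀ X ∈ Icc b Xc, derivWithin P (Icc 0 Xbar) X < 0 :=
    fun X hX => ha ⟨hab.trans_le hX.1, hX.2⟩
  have hP' (X : ℝ) (hX : X ∈ Icc 0 Xbar) :
      HasDerivWithinAt P (derivWithin P (Icc 0 Xbar) X) (Icc 0 Xbar) X :=
    (hsmooth.differentiableOn (by simp) X hX).hasDerivWithinAt
  refine ⟨b, fun X => (c - P X) / derivWithin P (Icc 0 Xbar) X, hc, ha0.trans hab.le, hbXc,
    hmargin, hanti, ?_, ?_, ?_, fun X hX => ?_⟩
  · exact (contDiffOn_const.sub (hsmooth.mono hsub)).div (hdP.mono hsub)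
      fun X hX => (hneg X hX).ne
  · simp [hPXc]
  · have h1 := ((hP' Xc hXc).mono hsub).const_sub c
    have h2 := ((hdP.differentiableOn (by simp) Xc hXc).mono hsub).hasDerivWithinAt
    refine (h1.div h2 hslope.ne).congr_deriv ?_
    have := hslope.ne
    rw [hPXc]
    field_simp
    ring
  · have hXI := Ioo_subset_Icc_self hX
    refine ⟨_, hneg X hXI, (hP' X (hsub hXI)).hasDerivAt (Icc_mem_nhds ?_ ?_),
      div_mul_cancel₀ _ (hneg X hXI).ne⟩
    · linarith [hX.1]
    · linarith [hX.2, hXc.2]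

theorem IsEquilibrium.firmQuantity_mem_Icc {P : ℝ → ℝ} {c : ℝ} {T : ℕ} {n : ℕ → ℕ} {σ : Profile}
    (h : IsEquilibrium P c T n σ) {s i : ℕ} (hs : s < T) (hi : i < n s) :
    firmQuantity n σ s i ∈ Icc 0 (totalQuantity T n σ) := by
  have hr := h.reachable_path hs.le
  refine ⟨h.nonneg s hs i hi _ hr, ?_⟩
  have h1 := h.quantity_le hs hi hr
  have h2 := h.le_finalQuantity hs (h.reachable_stage hs hr)
  rw [← finalQuantity_stage hs, finalQuantity_path hs.le] at h2
  have := hr.1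
  rw [firmQuantity]
  linarith

end SequentialOligopoly

theorem proposition2
    -- inverse demand: smooth and strictly decreasing up to the saturation point, zero from there on
    (P : ℝ → ℝ) (Xbar : ℝ) (hXbar : 0 < Xbar)
    (hsmooth : ContDiffOn ℝ ∞ P (Icc 0 Xbar))
    (hanti : StrictAntiOn P (Icc 0 Xbar))
    (hsat : ∀ X, 0 ≤ X → (P X = 0 ↔ Xbar ≤ X))
    -- marginal cost and the competitive quantity, where demand is not flat
    (c : ℝ) (hc : 0 ≤ c) (Xc : ℝ) (hXc : Xc ∈ Icc 0 Xbar) (hPXc : P Xc = c)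
    (hslope : derivWithin P (Icc 0 Xbar) Xc < 0)
    -- number of firms per period (periods `0, …, T - 1`), and the period `t` in which it is varied
    (T : ℕ) (n : ℕ → ℕ) (t : ℕ) (ht : t < T)
    -- for each large `N`, an equilibrium of the game with `N` firms in period `t`
    (σ : ℕ → Profile)
    (heq : ∀ᶠ N in atTop, IsEquilibrium P c T (Function.update n t N) (σ N))
    (hunsat : c = 0 → ∀ᶠ N in atTop, StaysUnsaturated Xbar T (Function.update n t N) (σ N)) :
    Tendsto (fun N => totalQuantity T (Function.update n t N) (σ N)) atTop (𝓝 Xc) ∧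
    -- `i N` is any choice of a firm of period `s` in the game with `N` firms in period `t`
    ∀ s < T, ∀ i : ℕ → ℕ, (∀ᶠ N in atTop, i N < Function.update n t N s) →
      Tendsto (fun N => firmQuantity (Function.update n t N) (σ N) s (i N)) atTop
        (𝓝 (if t ≤ s then 0 else Xc / ∏ k ∈ Finset.range (s + 1), (1 + (n k : ℝ)))) := by
  have hP0 (X : ℝ) (hX : Xbar ≤ X) : P X = 0 := (hsat X (hXbar.le.trans hX)).2 hX
  have hXbarI : Xbar ∈ Icc 0 Xbar := right_mem_Icc.2 hXbar.le
  have hanti' : AntitoneOn P (Ici 0) := by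
    intro X hX Y hY hXY
    rcases le_or_gt Xbar Y with hYb | hYb
    · rw [hP0 Y hYb]
      rcases le_or_gt Xbar X with hXb | hXb
      · exact (hP0 X hXb).ge
      · rw [← hP0 Xbar le_rfl]
        exact hanti.antitoneOn ⟨hX, hXb.le⟩ hXbarI hXb.le
    · exact hanti.antitoneOn ⟨hX, hXY.trans hYb.le⟩ ⟨hY, hYb.le⟩ hXY
  have hmargin (X : ℝ) (hX : 0 ≤ X) (hXc' : X < Xc) : c < P X :=
    hPXc ▸ hanti ⟨hX, hXc'.le.trans hXc.2⟩ hXc hXc'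
  have hloss (hcpos : 0 < c) (X : ℝ) (hX : Xc < X) : P X < c := by
    rcases le_or_gt Xbar X with hXb | hXb
    · rwa [hP0 X hXb]
    · exact hPXc ▸ hanti hXc ⟨hXc.1.trans hX.le, hXb.le⟩ hX
  -- If `Xc = 0` there is no interval to its left to work on, but then `c > 0` and nothing is
  -- produced on the path.
  rcases hXc.1.eq_or_lt with hzero | hpos
  · have hcpos : 0 < c := hc.lt_of_ne fun h0 => by
      have := (hsat Xc hXc.1).1 (hPXc.trans h0.symm)
      linarith
    have htotal : ∀ᶠ N in atTop, totalQuantity T (Function.update n t N) (σ N) = 0 ∧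
        IsEquilibrium P c T (Function.update n t N) (σ N) := by
      filter_upwards [heq] with N hN
      have hr : Reachable (Function.update n t N) 0 0 := ⟨le_rfl, fun _ => rfl⟩
      exact ⟨le_antisymm ((hN.finalQuantity_le_competitive (hloss hcpos) T.zero_le hr
        hXc.1).trans_eq hzero.symm) (hN.le_finalQuantity T.zero_le hr), hN⟩
    rw [← hzero]
    refine ⟨tendsto_const_nhds.congr' (htotal.mono fun N hN => hN.1.symm), fun s hs i hi => ?_⟩
    rw [zero_div, ite_self]
    refine tendsto_const_nhds.congr' ?_
    filter_upwards [htotal, hi] with N hN hiN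
    have := hN.2.firmQuantity_mem_Icc hs hiN
    rw [hN.1, Icc_self] at this
    exact this.symm
  · obtain ⟨a, φ, hR⟩ := exists_competitiveRegion hsmooth hXbar hc hXc hpos hPXc hslope hmargin
      hanti'
    refine hR.tendsto_path ht heq ?_
    rcases hc.eq_or_lt with h0 | hcpos
    -- At zero cost overproduction causes no loss, so the bound on totals has to come from `hunsat`.
    · have hXb : Xc = Xbar := le_antisymm hXc.2 ((hsat Xc hXc.1).1 (hPXc.trans h0.symm))
      filter_upwards [hunsat h0.symm] with N hN s hs Y hY hYc
      rcases hs.eq_or_lt with rfl | hsT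
      · rwa [finalQuantity_end]
      · exact (hN s hsT Y hY (hYc.trans_eq hXb)).trans_eq hXb.symm
    · filter_upwards [heq] with N hN s hs Y hY hYc
      exact hN.finalQuantity_lt_competitive (hloss hcpos) hPXc hmargin hs hY hYc
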